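/- Let $p,q,r\ge 0$ be integers with $n=p+q+r\ge 1$, and let $\mathcal G=\mathcal G_{p,q,r}$ be the real geometric (Clifford) algebra of $\mathbb R^{p,q,r}$ or the complex one of $\mathbb C^{p+q,0,r}$. That is, $\mathcal G$ is the Clifford algebra with generators $e_1,\dots,e_n$ and relations $e_ae_b+e_be_a=2\eta_{ab}$, where $\eta$ is diagonal with $p$ entries $+1$, then $q$ entries $-1$, then $r$ entries $0$ in the real case, and with $p+q$ entries $+1$, then $r$ entries $0$ in the complex case. Write $\widehat U$ for the grade involution, $\widetilde U$ for the reversion, $\mathcal G^\times$ for the group of invertible elements, and $H^\times=H\cap\mathcal G^\times$ for $H\subseteq\mathcal G$. Let $\mathcal G^m$ be the subspace of grade $m$, spanned by the products $e_{a_1}\cdots e_{a_m}$ with $a_1<\dots<a_m$ (so $\mathcal G^m=\{0\}$ for $m>n$), and let $$\mathrm Z^m=\{X\in\mathcal G:\ XV=VX\ \text{ for all } V\in\mathcal G^m\}.$$ For $k=0,1,2,3$ define $$\mathcal G^{\overline k}=\{U\in\mathcal G:\ \widehat U=(-1)^kU,\ \widetilde U=(-1)^{k(k-1)/2}U\},\qquad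 \Gamma^{\overline k}=\{T\in\mathcal G^\times:\ T\,\mathcal G^{\overline k}\,T^{-1}\subseteq\mathcal G^{\overline k}\},$$ $$\mathrm Q^{\overline k}=\{T\in\mathcal G^\times:\ \widetilde T\,T\in\mathrm Z^{m\times}\ \text{ and }\ \widehat{\widetilde T}\,T\in\mathrm Z^{m\times}\},\qquad m=k\ \text{ if } k=1,2,3,\quad m=4\ \text{ if } k=0.$$ Then $$\mathrm Q^{\overline k}=\Gamma^{\overline k}\quad(k=0,1,2,3),\qquad \Gamma^{\overline 1}\subseteq\Gamma^{\overline m}\subseteq\Gamma^{\overline 0}\quad(m=0,1,2,3).$$ -/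

import Mathlib

namespace GeomAlg

/-- The diagonal of the matrix of the real form: `p` times `+1`, `q` times `-1`, `r` times `0`. -/
def etaReal (p q r : ℕ) : Fin (p + q + r) → ℝ :=
  fun a => if (a : ℕ) < p then 1 else if (a : ℕ) < p + q then -1 else 0

/-- The diagonal of the matrix of the complex form: `p + q` times `+1`, `r` times `0`. -/
def etaComplex (p q r : ℕ) : Fin (p + q + r) → ℂ :=
  fun a => if (a : ℕ) < p + q then 1 else 0

section

variable {F : Type*} [Field F] {n : ℕ}

/-- The geometric (Clifford) algebra of `Fⁿ` with the diagonal quadratic form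
`x ↦ ∑ a, η a * x a ^ 2`. -/
abbrev Alg (η : Fin n → F) : Type _ :=
  CliffordAlgebra (QuadraticMap.weightedSumSquares F η)

/-- The generators `e_a`. -/
def gen (η : Fin n → F) (a : Fin n) : Alg η :=
  CliffordAlgebra.ι (QuadraticMap.weightedSumSquares F η) (Pi.single a 1)

/-- The element `e_A = e_{a₁} ⋯ e_{aₖ}` for `A = {a₁ < ⋯ < aₖ}`; it is `1` for `A = ∅`. -/
def blade (η : Fin n → F) (A : Finset (Fin n)) : Alg η :=
  ((A.sort (· ≤ ·)).map (gen η)).prod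

/-- The subspace of grade `m`; it is zero for `m > n`. -/
def gradeSpace (η : Fin n → F) (m : ℕ) : Submodule F (Alg η) :=
  Submodule.span F {x | ∃ A : Finset (Fin n), A.card = m ∧ x = blade η A}

/-- The subspace of quaternion type `k`. -/
def quatType (η : Fin n → F) (k : Fin 4) : Set (Alg η) :=
  {U | CliffordAlgebra.involute U = (-1) ^ (k : ℕ) * U ∧
       CliffordAlgebra.reverse U = (-1) ^ ((k : ℕ) * ((k : ℕ) - 1) / 2) * U}

/-- The centralizer `Z^m` of the subspace of grade `m`. -/
def cent (η : Fin n → F) (m : ℕ) : Set (Alg η) :=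
  {X | ∀ V ∈ gradeSpace η m, X * V = V * X}

/-- The set of the invertible elements of a set `H`. -/
def invertibles {η : Fin n → F} (H : Set (Alg η)) : Set (Alg η) :=
  {X | X ∈ H ∧ IsUnit X}

/-- The norm function `ψ`: the reverse of `T` times `T`. -/
def psi {η : Fin n → F} (T : Alg η) : Alg η :=
  CliffordAlgebra.reverse T * T

/-- The norm function `χ`: the Clifford conjugate of `T` times `T`. -/
def chi {η : Fin n → F} (T : Alg η) : Alg η :=
  CliffordAlgebra.involute (CliffordAlgebra.reverse T) * T

/-- The adjoint action. -/
def ad {η : Fin n → F} (T : (Alg η)ˣ) (U : Alg η) : Alg η :=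
  (T : Alg η) * U * ((T⁻¹ : (Alg η)ˣ) : Alg η)

/-- `Γ^k`: the invertible elements that preserve the subspace of quaternion type `k`
under the adjoint action. -/
def Gam (η : Fin n → F) (k : Fin 4) : Set (Alg η)ˣ :=
  {T | ad T '' quatType η k ⊆ quatType η k}

/-- The grade `m` that goes with the quaternion type `k`: `m = k` for `k = 1, 2, 3` and
`m = 4` for `k = 0`. -/
def gradeOf (k : Fin 4) : ℕ := if k = 0 then 4 else (k : ℕ)

/-- `Q^k`: the invertible elements whose two norms are invertible elements of `Z^m`, where
`m = k` for `k = 1, 2, 3` and `m = 4` for `k = 0`. -/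
def QGroup (η : Fin n → F) (k : Fin 4) : Set (Alg η)ˣ :=
  {T | psi (T : Alg η) ∈ invertibles (cent η (gradeOf k)) ∧
       chi (T : Alg η) ∈ invertibles (cent η (gradeOf k))}

end

end GeomAlg

/-! Everything reduces to centralizers. Reversion and Clifford conjugation are anti-automorphisms
`σ` acting on each quaternion type by a sign, so `σ(T U T⁻¹) = ± σ(T)⁻¹ U σ(T)`, and `T U T⁻¹` keeps
the type of `U` exactly when both norms `σ(T) T` commute with `U` (`ad_mem_quatType_iff`). Since
type `k` is spanned by the blades of grade congruent to `k` modulo 4, it remains to show that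
commuting with the least positive such grade `m` forces commuting with the higher ones
(`cent_commutes`); the inclusions follow from the same fact.

For that, let `τ_i` be the automorphism with `x e_i = e_i τ_i(x)`. The `τ_i` are commuting
involutions preserving `Z^m`, so `x` may be taken to be a joint eigenvector with signs `ε_i`; then
`x e_A = (∏_{i ∈ A} ε_i) e_A x`. If every `m`-subset of `A` has sign product 1, so has `A`
(`prod_signs_eq_one`). Otherwise some `T ⊆ A` of size `m` gives `x e_T = -e_T x = -x e_T`, hence `x
e_T = 0`, and both `x e_A` and `e_A x` vanish. No inverse of a blade is used, so degenerate forms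
are covered; only `2 ≠ 0` matters. -/

namespace GeomAlg

open CliffordAlgebra

/-! ### Joint eigenvectors and products of signs. -/

/-- A submodule stable under a commuting family of involutions is contained in any submodule
that contains its joint eigenvectors. -/
lemma le_of_joint_eigenvectors {F V ι : Type*} [Field F] [NeZero (2 : F)] [AddCommGroup V]
    [Module F V] [Finite ι] (τ : ι → V →ₗ[F] V) (hτ : ∀ i x, τ i (τ i x) = x)
    (hc : ∀ i j x, τ i (τ j x) = τ j (τ i x)) (Z p : Submodule F V)
    (hZ : ∀ i, ∀ x ∈ Z, τ i x ∈ Z)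
    (h : ∀ ε : ι → ℤˣ, ∀ x ∈ Z, (∀ i, τ i x = ε i • x) → x ∈ p) : Z ≤ p := by
  classical
  have := Fintype.ofFinite ι
  -- Induction on the set `s` of indices for which `x` need not be an eigenvector.
  suffices H : ∀ s : Finset ι, ∀ ε : ι → ℤˣ, ∀ x ∈ Z, (∀ i, i ∉ s → τ i x = ε i • x) → x ∈ p from
    fun x hx => H Finset.univ 1 x hx (by simp)
  intro s
  induction s using Finset.induction_on with
  | empty => exact fun ε x hx hε => h ε x hx fun i => hε i (by simp)
  | insert a s ha ih =>
    intro ε x hx hε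
    -- `x ± τ_a x` is an eigenvector of `τ_a` with eigenvalue `±1`, and half the sum of the two is
    -- `x`.
    have key : ∀ u : ℤˣ, x + u • τ a x ∈ p := by
      intro u
      refine ih (Function.update ε a u) _ ?_ ?_
      · rcases Int.units_eq_one_or u with rfl | rfl
        · simpa using Z.add_mem hx (hZ a x hx)
        · simpa using Z.add_mem hx (Z.neg_mem (hZ a x hx))
      · intro i hi
        by_cases hia : i = a
        · subst hia
          rcases Int.units_eq_one_or u with rfl | rfl <;> simp [hτ, add_comm]
        · have h1 := hε i (by simp [hia, hi])
          rw [Function.update_of_ne hia]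
          rcases Int.units_eq_one_or u with rfl | rfl <;>
          rcases Int.units_eq_one_or (ε i) with h2 | h2 <;> simp [hc i a, h1, h2]
    have h3 := p.smul_mem (2⁻¹ : F) (p.add_mem (key 1) (key (-1)))
    have h4 : (2⁻¹ : F) • (x + (1 : ℤˣ) • τ a x + (x + (-1 : ℤˣ) • τ a x)) = x := by
      have : x + (1 : ℤˣ) • τ a x + (x + (-1 : ℤˣ) • τ a x) = (2 : F) • x := by
        rw [two_smul]; simp; abel
      rw [this, smul_smul, inv_mul_cancel₀ (NeZero.ne _), one_smul]
    rwa [h4] at h3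

/-- If all products of `m` signs out of a family are `1`, so is the total product, provided that
the family is large enough and of even size when `m` is even. -/
lemma prod_signs_eq_one {ι : Type*} [DecidableEq ι] (ε : ι → ℤˣ) (A : Finset ι) {m : ℕ}
    (hm : 1 ≤ m) (hA : m ≤ A.card) (he : Even m → Even A.card)
    (h : ∀ T ⊆ A, T.card = m → ∏ i ∈ T, ε i = 1) : ∏ i ∈ A, ε i = 1 := by
  rcases hA.eq_or_lt with hA | hA
  · exact h A subset_rfl hA.symm
  -- Since `m < |A|`, some `S` of size `m - 1` avoids both `a` and `b`; comparing the products over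
  -- `S ∪ {a}` and `S ∪ {b}` gives `ε a = ε b`.
  have hconst : ∀ a ∈ A, ∀ b ∈ A, ε a = ε b := by
    intro a ha b hb
    by_cases hab : a = b
    · rw [hab]
    have hc : m - 1 ≤ ((A.erase a).erase b).card := by
      rw [Finset.card_erase_of_mem (by simp [hb, Ne.symm hab]), Finset.card_erase_of_mem ha]
      omega
    obtain ⟨S, hS, hSm⟩ := Finset.exists_subset_card_eq hc
    have hSa : a ∉ S := fun h' => by simpa using hS h'
    have hSb : b ∉ S := fun h' => by simpa using hS h'
    have hSA : S ⊆ A := hS.trans ((Finset.erase_subset _ _).trans (Finset.erase_subset _ _))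
    have h1 := h (insert a S) (Finset.insert_subset ha hSA)
      (by rw [Finset.card_insert_of_notMem hSa]; omega)
    have h2 := h (insert b S) (Finset.insert_subset hb hSA)
      (by rw [Finset.card_insert_of_notMem hSb]; omega)
    rw [Finset.prod_insert hSa] at h1
    rw [Finset.prod_insert hSb, ← h1] at h2
    exact (mul_right_cancel h2).symm
  obtain ⟨a, ha⟩ : A.Nonempty := Finset.card_pos.mp (by omega)
  have hpow : ∀ T ⊆ A, ∏ i ∈ T, ε i = ε a ^ T.card := fun T hT =>
    Finset.prod_eq_pow_card fun i hi => hconst i (hT hi) a ha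
  obtain ⟨T, hT, hTm⟩ := Finset.exists_subset_card_eq hA.le
  have h1 := h T hT hTm
  rw [hpow T hT, hTm] at h1
  rw [hpow A subset_rfl]
  rcases Int.units_eq_one_or (ε a) with h2 | h2
  · simp [h2]
  -- With all signs `-1`, the hypothesis reads `(-1)^m = 1`, so `m` is even, and then so is `|A|`.
  · rw [h2] at h1 ⊢
    refine (he ?_).neg_one_pow
    by_contra ho
    rw [(Nat.not_even_iff_odd.mp ho).neg_one_pow] at h1
    exact absurd h1 (by decide)

section

variable {F : Type*} [Field F] {n : ℕ} (η : Fin n → F)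

/-! ### The automorphisms that move a generator across an element. -/

/-- The isometry that fixes the `i`-th coordinate and negates the others. -/
def axisIsometry (i : Fin n) :
    QuadraticMap.weightedSumSquares F η →qᵢ QuadraticMap.weightedSumSquares F η where
  toFun v j := if j = i then v j else - v j
  map_add' v w := by ext j; dsimp; split_ifs <;> ring
  map_smul' c v := by ext j; dsimp; split_ifs <;> ring
  map_app' v := by
    simp only [QuadraticMap.weightedSumSquares_apply]
    refine Finset.sum_congr rfl fun j _ => ?_
    split_ifs <;> simp

lemma axisIsometry_apply (i : Fin n) (v : Fin n → F) (j : Fin n) :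
    axisIsometry η i v j = if j = i then v j else - v j := rfl

/-- The automorphism of the Clifford algebra that fixes `e_i` and negates the other generators. -/
def axisMap (i : Fin n) : Alg η →ₐ[F] Alg η := CliffordAlgebra.map (axisIsometry η i)

lemma axisMap_gen (i j : Fin n) :
    axisMap η i (gen η j) = if j = i then gen η j else - gen η j := by
  rw [axisMap, gen, map_apply_ι]
  have : axisIsometry η i (Pi.single j 1) =
      if j = i then Pi.single j 1 else - (Pi.single j 1 : Fin n → F) := by
    ext k
    rw [axisIsometry_apply]
    by_cases hk : k = j
    · subst hk; split_ifs <;> simp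
    · split_ifs <;> simp [hk]
  rw [this]
  split_ifs <;> simp

lemma axisMap_axisMap (i : Fin n) (x : Alg η) : axisMap η i (axisMap η i x) = x := by
  have : (axisMap η i).comp (axisMap η i) = AlgHom.id F _ := by
    ext v
    simp only [axisMap, AlgHom.toLinearMap_apply, LinearMap.comp_apply, AlgHom.comp_apply,
      map_apply_ι, AlgHom.id_apply]
    congr 1
    ext j
    simp only [axisIsometry_apply]
    split_ifs <;> simp
  exact DFunLike.congr_fun this x

lemma axisMap_comm (i j : Fin n) (x : Alg η) :
    axisMap η i (axisMap η j x) = axisMap η j (axisMap η i x) := by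
  have : (axisMap η i).comp (axisMap η j) = (axisMap η j).comp (axisMap η i) := by
    ext v
    simp only [axisMap, AlgHom.toLinearMap_apply, LinearMap.comp_apply, AlgHom.comp_apply,
      map_apply_ι]
    congr 1
    ext k
    simp only [axisIsometry_apply]
    split_ifs <;> simp
  exact DFunLike.congr_fun this x

lemma polar_single (i : Fin n) (v : Fin n → F) :
    QuadraticMap.polar (QuadraticMap.weightedSumSquares F η) v (Pi.single i 1) =
      2 * v i * η i := by
  simp only [QuadraticMap.polar, QuadraticMap.weightedSumSquares_apply, smul_eq_mul,
    ← Finset.sum_sub_distrib]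
  rw [Finset.sum_eq_single i]
  · simp; ring
  · intro j _ hj
    simp [hj]
  · simp

lemma gen_mul_self (i : Fin n) : gen η i * gen η i = algebraMap F _ (η i) := by
  rw [gen, ι_sq_scalar]
  congr 1
  rw [QuadraticMap.weightedSumSquares_apply, Finset.sum_eq_single i]
  · simp
  · intro j _ hj; simp [hj]
  · simp

/-- On vectors this is the Clifford relation; both sides are additive, and multiplicativity of
`axisMap` carries it to products. It turns commutation with `e_i` into an eigenvalue question
without inverting `e_i`. -/
lemma mul_gen (i : Fin n) (x : Alg η) : x * gen η i = gen η i * axisMap η i x := by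
  induction x using CliffordAlgebra.induction with
  | algebraMap r => simp [Algebra.commutes]
  | ι v =>
    -- Negated reflection along `e_i`, written without division by `η i`, which may be zero.
    have h1 : axisIsometry η i v = (2 * v i) • Pi.single i 1 - v := by
      ext j
      rw [axisIsometry_apply]
      by_cases hj : j = i
      · subst hj; simp; ring
      · simp [hj]
    have h2 : gen η i * ι _ v + ι _ v * gen η i = algebraMap F _ (2 * v i * η i) := by
      rw [← polar_single, add_comm, gen, ι_mul_ι_add_swap]
    rw [axisMap, map_apply_ι, h1, map_sub, map_smul, ← gen, mul_sub, mul_smul_comm, gen_mul_self,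
      eq_sub_iff_add_eq', h2, map_mul, Algebra.smul_def]
  | mul x y hx hy => rw [mul_assoc, hy, ← mul_assoc, hx, mul_assoc, map_mul]
  | add x y hx hy => rw [add_mul, hx, hy, map_add, mul_add]

lemma gen_mul_gen {i j : Fin n} (h : i ≠ j) : gen η i * gen η j = - (gen η j * gen η i) := by
  rw [mul_gen, axisMap_gen, if_neg h, mul_neg]

/-! ### Blades: products, spanning, and the two involutions. -/

/-- Reordering distinct generators changes their product by a sign. -/
lemma exists_sign_of_perm {l l' : List (Fin n)} (h : l.Perm l') (hl : l.Nodup) :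
    ∃ u : ℤˣ, (l.map (gen η)).prod = u • (l'.map (gen η)).prod := by
  induction h with
  | nil => exact ⟨1, by simp⟩
  | cons a _ ih =>
    obtain ⟨u, hu⟩ := ih (List.nodup_cons.mp hl).2
    exact ⟨u, by simp [hu, mul_smul_comm]⟩
  | swap a b l =>
    have hab : b ≠ a := by rintro rfl; simp at hl
    exact ⟨-1, by simp [← mul_assoc, gen_mul_gen η hab]⟩
  | trans h1 _ ih1 ih2 =>
    obtain ⟨u, hu⟩ := ih1 hl
    obtain ⟨v, hv⟩ := ih2 (h1.nodup_iff.mp hl)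
    exact ⟨u * v, by rw [hu, hv, smul_smul]⟩

lemma exists_sign_blade_mul (S T : Finset (Fin n)) (h : Disjoint S T) :
    ∃ u : ℤˣ, blade η (S ∪ T) = u • (blade η S * blade η T) := by
  have hp : ((S ∪ T).sort (· ≤ ·)).Perm (S.sort (· ≤ ·) ++ T.sort (· ≤ ·)) := by
    refine (List.perm_ext_iff_of_nodup (Finset.sort_nodup _ _) ?_).mpr fun a => by simp
    refine List.nodup_append'.mpr ⟨Finset.sort_nodup _ _, Finset.sort_nodup _ _, ?_⟩
    intro a ha hb
    exact Finset.disjoint_left.mp h (by simpa using ha) (by simpa using hb)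
  obtain ⟨u, hu⟩ := exists_sign_of_perm η hp (Finset.sort_nodup _ _)
  exact ⟨u, by simpa [blade] using hu⟩

lemma blade_singleton (i : Fin n) : blade η {i} = gen η i := by simp [blade]

lemma blade_empty : blade η ∅ = 1 := by simp [blade]

/-- The span contains 1 and is stable under left multiplication by generators: `e_i e_A` is `±e_{A ∪
{i}}` if `i ∉ A`, and `±η_i e_{A \ {i}}` otherwise. -/
lemma span_blade : Submodule.span F (Set.range (blade η)) = ⊤ := by
  set W := Submodule.span F (Set.range (blade η))
  have hsign : ∀ (u : ℤˣ) (x : Alg η), x ∈ W → u • x ∈ W := by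
    intro u x hx
    rcases Int.units_eq_one_or u with rfl | rfl
    · simpa using hx
    · simpa using hx
  have hgen : ∀ i, ∀ x ∈ W, gen η i * x ∈ W := by
    intro i x hx
    induction hx using Submodule.span_induction with
    | mem x hx =>
      obtain ⟨A, rfl⟩ := hx
      by_cases hi : i ∈ A
      · obtain ⟨u, hu⟩ := exists_sign_blade_mul η {i} (A.erase i) (by simp)
        have hA : {i} ∪ A.erase i = A := by ext j; by_cases j = i <;> simp_all
        rw [hA, blade_singleton] at hu
        rw [hu, mul_smul_comm, ← mul_assoc, gen_mul_self, ← Algebra.smul_def]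
        exact hsign _ _ (W.smul_mem _ (Submodule.subset_span ⟨_, rfl⟩))
      · obtain ⟨u, hu⟩ := exists_sign_blade_mul η {i} A (by simpa using hi)
        rw [blade_singleton] at hu
        have : gen η i * blade η A = u⁻¹ • blade η ({i} ∪ A) := by rw [hu, inv_smul_smul]
        rw [this]
        exact hsign _ _ (Submodule.subset_span ⟨_, rfl⟩)
    | zero => simp
    | add x y _ _ hx hy => rw [mul_add]; exact W.add_mem hx hy
    | smul c x _ hx => rw [mul_smul_comm]; exact W.smul_mem c hx
  refine eq_top_iff.mpr fun x _ => ?_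
  induction x using CliffordAlgebra.left_induction with
  | algebraMap r =>
    rw [Algebra.algebraMap_eq_smul_one, ← blade_empty η]
    exact W.smul_mem _ (Submodule.subset_span ⟨_, rfl⟩)
  | add x y hx hy => exact W.add_mem (hx trivial) (hy trivial)
  | ι_mul x v hx =>
    rw [pi_eq_sum_univ' v, map_sum, Finset.sum_mul]
    refine W.sum_mem fun i _ => ?_
    rw [map_smul, smul_mul_assoc]
    refine W.smul_mem _ ?_
    have : (fun j => if i = j then (1 : F) else 0) = Pi.single i 1 := by
      ext j; simp [Pi.single_apply, eq_comm]
    simpa [this, gen] using hgen i x (hx trivial)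

lemma axisMap_list_prod (i : Fin n) (l : List (Fin n)) :
    ∃ u : ℤˣ, axisMap η i (l.map (gen η)).prod = u • (l.map (gen η)).prod := by
  induction l with
  | nil => exact ⟨1, by simp⟩
  | cons a l ih =>
    obtain ⟨u, hu⟩ := ih
    by_cases h : a = i
    · exact ⟨u, by simp [hu, axisMap_gen, h, mul_smul_comm]⟩
    · exact ⟨-u, by simp [hu, axisMap_gen, h, mul_smul_comm]⟩

lemma axisMap_list_prod_of_notMem {i : Fin n} {l : List (Fin n)} (hi : i ∉ l) :
    axisMap η i (l.map (gen η)).prod = (-1) ^ l.length * (l.map (gen η)).prod := by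
  induction l with
  | nil => simp
  | cons a l ih =>
    simp only [List.mem_cons, not_or] at hi
    simp only [List.map_cons, List.prod_cons, map_mul, ih hi.2, axisMap_gen, Ne.symm hi.1,
      if_false, List.length_cons, pow_succ]
    rcases neg_one_pow_eq_or (Alg η) l.length with h | h <;> simp [h]

lemma involute_blade (A : Finset (Fin n)) :
    involute (blade η A) = (-1) ^ A.card * blade η A := by
  have : ∀ l : List (Fin n),
      involute (l.map (gen η)).prod = (-1) ^ l.length * (l.map (gen η)).prod := by
    intro l
    induction l with
    | nil => simp
    | cons a l ih =>
      rw [List.map_cons, List.prod_cons, map_mul, ih, gen, involute_ι, List.length_cons, pow_succ]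
      rcases neg_one_pow_eq_or (Alg η) l.length with h | h <;> simp [h]
  simpa [blade] using this (A.sort (· ≤ ·))

lemma reverse_blade (A : Finset (Fin n)) :
    reverse (blade η A) = (-1) ^ (A.card * (A.card - 1) / 2) * blade η A := by
  have : ∀ l : List (Fin n), l.Nodup → reverse (l.map (gen η)).prod =
      (-1) ^ (l.length * (l.length - 1) / 2) * (l.map (gen η)).prod := by
    intro l hl
    induction l with
    | nil => simp
    | cons a l ih =>
      obtain ⟨ha, hl⟩ := List.nodup_cons.mp hl
      have hr : reverse (gen η a) = gen η a := reverse_ι _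
      have hlen : (l.length + 1) * (l.length + 1 - 1) / 2 =
          l.length * (l.length - 1) / 2 + l.length := by
        rcases l.length with _ | k
        · rfl
        · rw [← Nat.add_mul_div_right _ _ two_pos]
          congr 1
          simp only [Nat.add_sub_cancel]
          ring
      rw [List.map_cons, List.prod_cons, reverse.map_mul, ih hl, hr, mul_assoc, mul_gen,
        axisMap_list_prod_of_notMem η ha, List.length_cons, hlen, pow_add]
      rcases neg_one_pow_eq_or (Alg η) l.length with h | h <;> simp [h]
  simpa [blade] using this (A.sort (· ≤ ·)) (Finset.sort_nodup _ _)

/-! ### Centralizers and the automorphisms. -/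

/-- The centralizer of the subspace of grade `m`, as a submodule. -/
def centSubmodule (m : ℕ) : Submodule F (Alg η) where
  carrier := cent η m
  add_mem' hx hy V hV := by rw [add_mul, mul_add, hx V hV, hy V hV]
  zero_mem' V _ := by simp
  smul_mem' c x hx V hV := by rw [smul_mul_assoc, mul_smul_comm, hx V hV]

/-- The centralizer of an element, as a submodule. -/
def commSubmodule (y : Alg η) : Submodule F (Alg η) where
  carrier := {x | x * y = y * x}
  add_mem' {a b} (hx : _ = _) (hy : _ = _) := show _ = _ by rw [add_mul, mul_add, hx, hy]
  zero_mem' := show _ = _ by simp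
  smul_mem' c x (hx : _ = _) := show _ = _ by rw [smul_mul_assoc, mul_smul_comm, hx]

lemma mem_cent_iff {m : ℕ} {x : Alg η} :
    x ∈ cent η m ↔ ∀ A : Finset (Fin n), A.card = m → x * blade η A = blade η A * x := by
  refine ⟨fun h A hA => h _ (Submodule.subset_span ⟨A, hA, rfl⟩), fun h V hV => ?_⟩
  induction hV using Submodule.span_induction with
  | mem V hV => obtain ⟨A, hA, rfl⟩ := hV; exact h A hA
  | zero => simp
  | add V W _ _ hV hW => rw [add_mul, mul_add, hV, hW]
  | smul c V _ hV => rw [smul_mul_assoc, mul_smul_comm, hV]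

/-- The automorphism sends each blade to plus or minus itself, so it preserves the relations that
define the centralizer. -/
lemma axisMap_mem_cent {m : ℕ} (i : Fin n) {x : Alg η} (hx : x ∈ cent η m) :
    axisMap η i x ∈ cent η m := by
  rw [mem_cent_iff] at hx ⊢
  intro A hA
  obtain ⟨u, hu⟩ := axisMap_list_prod η i (A.sort (· ≤ ·))
  change axisMap η i (blade η A) = u • blade η A at hu
  have h := congrArg (axisMap η i) (hx A hA)
  rw [map_mul, map_mul, hu, mul_smul_comm, smul_mul_assoc] at h
  exact smul_left_cancel u h

lemma mul_blade_of_eigenvector {x : Alg η} {ε : Fin n → ℤˣ}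
    (h : ∀ i, axisMap η i x = ε i • x) (A : Finset (Fin n)) :
    x * blade η A = (∏ i ∈ A, ε i) • (blade η A * x) := by
  have : ∀ l : List (Fin n),
      x * (l.map (gen η)).prod = (l.map ε).prod • ((l.map (gen η)).prod * x) := by
    intro l
    induction l with
    | nil => simp
    | cons a l ih =>
      rw [List.map_cons, List.prod_cons, ← mul_assoc, mul_gen, h, mul_smul_comm, smul_mul_assoc,
        mul_assoc, ih, mul_smul_comm, smul_smul, List.map_cons, List.prod_cons, ← mul_assoc]
  have h2 := this (A.sort (· ≤ ·))
  rwa [← List.prod_toFinset _ (Finset.sort_nodup _ _), Finset.sort_toFinset] at h2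

/-! ### Quaternion types under conjugation. -/

/-- The sign of the grade involution on grade `c` depends on `c` modulo `4` only. -/
lemma neg_one_pow_mod_four {R : Type*} [Ring R] (c : ℕ) : (-1 : R) ^ c = (-1) ^ (c % 4) := by
  conv_lhs => rw [← Nat.div_add_mod c 4, pow_add, pow_mul]
  norm_num

/-- The sign of the reversion on grade `c` depends on `c` modulo `4` only. -/
lemma neg_one_pow_triangle_mod_four {R : Type*} [Ring R] (c : ℕ) :
    (-1 : R) ^ (c * (c - 1) / 2) = (-1) ^ (c % 4 * (c % 4 - 1) / 2) := by
  induction c using Nat.strong_induction_on with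
  | _ c ih =>
    rcases lt_or_ge c 4 with h | h
    · rw [Nat.mod_eq_of_lt h]
    · obtain ⟨d, rfl⟩ := Nat.exists_eq_add_of_le' h
      rw [Nat.add_mod_right, ← ih d (by omega)]
      have : (d + 4) * (d + 4 - 1) / 2 = d * (d - 1) / 2 + 2 * (2 * d + 3) := by
        rw [← Nat.add_mul_div_right _ _ two_pos]
        congr 1
        rcases d with _ | d
        · rfl
        · simp only [Nat.add_sub_cancel]
          change (d + 1 + 4) * (d + 4) = _
          ring
      rw [this, pow_add, pow_mul]
      simp

lemma blade_mem_quatType {k : Fin 4} {A : Finset (Fin n)} (hA : A.card % 4 = k) :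
    blade η A ∈ quatType η k := by
  refine ⟨?_, ?_⟩
  · rw [involute_blade, neg_one_pow_mod_four, hA]
  · rw [reverse_blade, neg_one_pow_triangle_mod_four, hA]

/-- For an anti-automorphism `σ` acting on `U` by a central sign, `σ` acts on `T U T⁻¹` by the same
sign exactly when `σ(T) T` commutes with `U`. -/
lemma anti_conj_iff {R : Type*} [Ring R] (σ : R → R) (hmul : ∀ a b, σ (a * b) = σ b * σ a)
    (hone : σ 1 = 1) (T : Rˣ) (U : R) (e : ℕ) (hU : σ U = (-1) ^ e * U) :
    σ (T * U * (T⁻¹ : Rˣ)) = (-1) ^ e * (T * U * (T⁻¹ : Rˣ)) ↔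
      σ T * T * U = U * (σ T * T) := by
  have h1 : σ (T⁻¹ : Rˣ) * σ T = 1 := by rw [← hmul, Units.mul_inv, hone]
  have h2 : σ T * σ (T⁻¹ : Rˣ) = 1 := by rw [← hmul, Units.inv_mul, hone]
  let S : Rˣ := ⟨σ T, σ (T⁻¹ : Rˣ), h2, h1⟩
  have h3 : σ (T * U * (T⁻¹ : Rˣ)) = (S⁻¹ : Rˣ) * ((-1) ^ e * U) * S := by
    rw [hmul, hmul, hU, ← mul_assoc]
    rfl
  have h4 : σ T = S := rfl
  rw [h3, h4]
  have h5 : ((S⁻¹ : Rˣ) : R) * ((-1) ^ e * U) * S = (-1) ^ e * ((S⁻¹ : Rˣ) * U * S) := by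
    rcases neg_one_pow_eq_or R e with h | h <;> simp [h]
  have h6 : IsUnit ((-1 : R) ^ e) := (isUnit_one.neg).pow e
  rw [h5, h6.mul_right_inj, Units.eq_mul_inv_iff_mul_eq, mul_assoc, mul_assoc,
    Units.inv_mul_eq_iff_eq_mul]
  simp only [mul_assoc]
  exact eq_comm

lemma ad_mem_quatType_iff (k : Fin 4) (T : (Alg η)ˣ) {U : Alg η} (hU : U ∈ quatType η k) :
    ad T U ∈ quatType η k ↔
      psi (T : Alg η) * U = U * psi (T : Alg η) ∧ chi (T : Alg η) * U = U * chi (T : Alg η) := by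
  obtain ⟨h1, h2⟩ := hU
  have hpsi := anti_conj_iff (fun x : Alg η => reverse x) reverse.map_mul reverse.map_one T U _ h2
  have hchi := anti_conj_iff (fun x : Alg η => involute (reverse x))
    (fun a b => by simp only [reverse.map_mul, map_mul]) (by simp) T U
    -- Clifford conjugation acts on type `k` by the product of the signs of reversion and grade
    -- involution.
    ((k : ℕ) * ((k : ℕ) - 1) / 2 + k) (by
      simp only [h2, map_mul, map_pow, map_neg, map_one, h1, pow_add, mul_assoc])
  rw [psi, chi, ← hpsi, ← hchi]
  change (involute (ad T U) = _ ∧ reverse (ad T U) = _) ↔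
    reverse (ad T U) = _ ∧ involute (reverse (ad T U)) = _
  rw [and_comm]
  refine and_congr_right fun h => ?_
  have h6 : IsUnit ((-1 : Alg η) ^ ((k : ℕ) * ((k : ℕ) - 1) / 2)) := (isUnit_one.neg).pow _
  rw [h, map_mul, map_pow, map_neg, map_one, pow_add, mul_assoc, h6.mul_right_inj]
  rfl

lemma mem_Gam_iff (k : Fin 4) (T : (Alg η)ˣ) :
    T ∈ Gam η k ↔ (∀ U ∈ quatType η k, psi (T : Alg η) * U = U * psi (T : Alg η)) ∧
      ∀ U ∈ quatType η k, chi (T : Alg η) * U = U * chi (T : Alg η) := by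
  rw [← forall₂_and]
  simp only [Gam, Set.mem_ofPred_eq, Set.image_subset_iff]
  exact forall₂_congr fun U hU => ad_mem_quatType_iff η k T hU

lemma isUnit_reverse (T : (Alg η)ˣ) : IsUnit (reverse (T : Alg η)) :=
  ⟨⟨reverse (T : Alg η), reverse ((T⁻¹ : (Alg η)ˣ) : Alg η),
    by rw [← reverse.map_mul, Units.inv_mul, reverse.map_one],
    by rw [← reverse.map_mul, Units.mul_inv, reverse.map_one]⟩, rfl⟩

/-- The norms of an invertible `T` are automatically invertible, so only the centralizer conditions
remain. -/
lemma mem_QGroup_iff (k : Fin 4) (T : (Alg η)ˣ) :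
    T ∈ QGroup η k ↔ psi (T : Alg η) ∈ cent η (gradeOf k) ∧
      chi (T : Alg η) ∈ cent η (gradeOf k) := by
  have h1 : IsUnit (psi (T : Alg η)) := (isUnit_reverse η T).mul T.isUnit
  have h2 : IsUnit (chi (T : Alg η)) := ((isUnit_reverse η T).map involute).mul T.isUnit
  simp only [QGroup, invertibles, Set.mem_ofPred_eq, h1, h2, and_true]

variable [NeZero (2 : F)]

/-! ### From grade `m` to a whole quaternion type. -/

lemma eq_zero_of_eq_neg {x : Alg η} (h : x = -x) : x = 0 := by
  have h2 : (2 : F) • x = 0 := by rw [two_smul]; nth_rewrite 1 [h]; simp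
  exact (smul_eq_zero.mp h2).resolve_left (NeZero.ne _)

/-- An element that commutes with grade `m` commutes with all larger grades, those of odd degree
excepted when `m` is even. -/
lemma cent_commutes {m : ℕ} (hm : 1 ≤ m) {x : Alg η} (hx : x ∈ cent η m) (A : Finset (Fin n))
    (hA : m ≤ A.card) (he : Even m → Even A.card) : x * blade η A = blade η A * x := by
  refine le_of_joint_eigenvectors (fun i => (axisMap η i).toLinearMap) (axisMap_axisMap η)
    (axisMap_comm η) (centSubmodule η m) (commSubmodule η (blade η A))
    (fun i y hy => axisMap_mem_cent η i hy) ?_ (show x ∈ centSubmodule η m from hx)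
  intro ε y hy hε
  change y * blade η A = blade η A * y
  have hmul := mul_blade_of_eigenvector η hε
  rcases Int.units_eq_one_or (∏ i ∈ A, ε i) with h1 | h1
  · rw [hmul, h1, one_smul]
  obtain ⟨T, hTA, hTm, hT⟩ : ∃ T ⊆ A, T.card = m ∧ ∏ i ∈ T, ε i ≠ 1 := by
    by_contra! hcon
    exact absurd ((prod_signs_eq_one ε A hm hA he hcon).symm.trans h1) (by decide)
  -- `y` both commutes and anticommutes with `e_T`. As `e_T` may be a zero divisor, this does not
  -- give `y = 0`, but it passes to `e_A = ±e_T e_{A \ T}`.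
  have hyT : y * blade η T = 0 := by
    refine eq_zero_of_eq_neg η ?_
    have h2 := hmul T
    rw [(Int.units_eq_one_or _).resolve_left hT, ← (mem_cent_iff η).mp hy T hTm] at h2
    simpa using h2
  have hyA : y * blade η A = 0 := by
    obtain ⟨u, hu⟩ := exists_sign_blade_mul η T (A \ T) Finset.disjoint_sdiff
    rw [Finset.union_sdiff_of_subset hTA] at hu
    rw [hu, mul_smul_comm, ← mul_assoc, hyT, zero_mul, smul_zero]
  have h3 := hmul A
  rw [h1, hyA] at h3
  have h4 : blade η A * y = 0 := by simpa using h3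
  rw [hyA, h4]

/-- Elements of a quaternion type are combinations of blades of that type. -/
lemma quatType_subset_span (k : Fin 4) :
    quatType η k ⊆ Submodule.span F {x | ∃ A : Finset (Fin n), A.card % 4 = k ∧ x = blade η A} := by
  set W := Submodule.span F {x | ∃ A : Finset (Fin n), A.card % 4 = k ∧ x = blade η A}
  have hsq : ∀ (a : ℕ) (x : Alg η), (-1) ^ a * ((-1) ^ a * x) = x := by
    intro a x
    rcases neg_one_pow_eq_or (Alg η) a with h | h <;> simp [h]
  -- Four times the projection onto type `k`: blades of type `k` are multiplied by 4, and the others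
  -- are killed because the pair of signs determines the grade modulo 4.
  have hproj : ∀ U : Alg η, ∀ V : Alg η,
      V = U + (-1) ^ (k : ℕ) * involute U →
      V + (-1) ^ ((k : ℕ) * ((k : ℕ) - 1) / 2) * reverse V ∈ W := by
    rintro U _ rfl
    have hU : U ∈ Submodule.span F (Set.range (blade η)) := by rw [span_blade]; trivial
    induction hU using Submodule.span_induction with
    | mem x hx =>
      obtain ⟨A, rfl⟩ := hx
      by_cases hA : A.card % 4 = k
      · have h1 := (blade_mem_quatType η hA).1
        have h2 := (blade_mem_quatType η hA).2
        have h3 : blade η A ∈ W := Submodule.subset_span ⟨A, hA, rfl⟩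
        rw [h1, hsq, map_add, h2, mul_add, hsq]
        exact W.add_mem (W.add_mem h3 h3) (W.add_mem h3 h3)
      · have h1 := involute_blade η A
        have h2 := reverse_blade η A
        rw [neg_one_pow_mod_four] at h1
        rw [neg_one_pow_triangle_mod_four] at h2
        have h3 : (-1 : Alg η) ^ 3 = -1 := by norm_num [pow_succ]
        have h4 : A.card % 4 < 4 := Nat.mod_lt _ (by norm_num)
        convert W.zero_mem
        clear_value W
        generalize A.card % 4 = c at *
        generalize blade η A = e at *
        interval_cases c <;> fin_cases k <;> simp [h3] at hA h1 h2 ⊢ <;> simp [h1, h2]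
    | zero => simp
    | add x y _ _ hx hy =>
      convert W.add_mem hx hy using 1
      simp only [map_add, mul_add]
      abel
    | smul c x _ hx =>
      convert W.smul_mem c hx using 1
      simp only [map_smul, mul_smul_comm, ← smul_add]
  rintro U ⟨h1, h2⟩
  have h3 := hproj U _ rfl
  rw [h1, hsq, map_add, h2, mul_add, hsq, ← two_smul F U, ← two_smul F, smul_smul] at h3
  exact (W.smul_mem_iff (mul_ne_zero (NeZero.ne _) (NeZero.ne _))).mp h3

lemma commutes_quatType_iff (k : Fin 4) (x : Alg η) :
    (∀ U ∈ quatType η k, x * U = U * x) ↔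
      ∀ A : Finset (Fin n), A.card % 4 = k → x * blade η A = blade η A * x := by
  refine ⟨fun h A hA => h _ (blade_mem_quatType η hA), fun h U hU => ?_⟩
  replace hU := quatType_subset_span η k hU
  rw [SetLike.mem_coe] at hU
  induction hU using Submodule.span_induction with
  | mem V hV => obtain ⟨A, hA, rfl⟩ := hV; exact h A hA
  | zero => simp
  | add V W _ _ hV hW => rw [add_mul, mul_add, hV, hW]
  | smul c V _ hV => rw [smul_mul_assoc, mul_smul_comm, hV]

lemma cent_commutes_quatType {k l : Fin 4} (hkl : k = l ∨ k = 1 ∨ l = 0) {x : Alg η}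
    (hx : x ∈ cent η (gradeOf k)) : ∀ U ∈ quatType η l, x * U = U * x := by
  rw [commutes_quatType_iff]
  intro A hA
  -- Grade 0 is central, so type 0 is governed by its next grade, 4.
  rcases A.eq_empty_or_nonempty with rfl | hne
  · simp [blade_empty]
  have hpos := hne.card_pos
  have hk : ∀ k : Fin 4, 1 ≤ gradeOf k ∧ gradeOf k ≤ 4 ∧ gradeOf k % 4 = k := by decide
  obtain ⟨h1, h2, h3⟩ := hk k
  simp only [Fin.ext_iff, Fin.val_one, Fin.val_zero] at hkl
  -- A nonempty `A` of type `l` has at least `gradeOf l` elements. For `k = l` this suffices; for `k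
  -- = 1` the grade is 1, which is odd; for `l = 0`, `|A|` is even and at least 4.
  refine cent_commutes η h1 hx A (by omega) ?_
  rw [Nat.even_iff, Nat.even_iff]
  omega

lemma mem_cent_of_commutes_quatType {k : Fin 4} {x : Alg η}
    (hx : ∀ U ∈ quatType η k, x * U = U * x) : x ∈ cent η (gradeOf k) := by
  rw [commutes_quatType_iff] at hx
  rw [mem_cent_iff]
  refine fun A hA => hx A ?_
  rw [hA]
  fin_cases k <;> rfl

/-! ### Equalities and inclusions of the groups. -/

theorem QGroup_eq_Gam (k : Fin 4) : QGroup η k = Gam η k := by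
  ext T
  rw [mem_QGroup_iff, mem_Gam_iff]
  exact and_congr
    ⟨cent_commutes_quatType η (Or.inl rfl), mem_cent_of_commutes_quatType η⟩
    ⟨cent_commutes_quatType η (Or.inl rfl), mem_cent_of_commutes_quatType η⟩

theorem Gam_subset_Gam {k l : Fin 4} (h : k = 1 ∨ l = 0) : Gam η k ⊆ Gam η l := by
  intro T hT
  rw [← QGroup_eq_Gam, mem_QGroup_iff] at hT
  rw [mem_Gam_iff]
  exact ⟨cent_commutes_quatType η (Or.inr h) hT.1, cent_commutes_quatType η (Or.inr h) hT.2⟩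

end

end GeomAlg

theorem mainTheorem1 (p q r : ℕ) (hn : 1 ≤ p + q + r) :
    -- the real algebra
    ((∀ k : Fin 4, GeomAlg.QGroup (GeomAlg.etaReal p q r) k =
          GeomAlg.Gam (GeomAlg.etaReal p q r) k) ∧
      (∀ m : Fin 4,
        GeomAlg.Gam (GeomAlg.etaReal p q r) 1 ⊆ GeomAlg.Gam (GeomAlg.etaReal p q r) m ∧
        GeomAlg.Gam (GeomAlg.etaReal p q r) m ⊆ GeomAlg.Gam (GeomAlg.etaReal p q r) 0)) ∧
    -- the complex algebra
    ((∀ k : Fin 4, GeomAlg.QGroup (GeomAlg.etaComplex p q r) k =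
          GeomAlg.Gam (GeomAlg.etaComplex p q r) k) ∧
      (∀ m : Fin 4,
        GeomAlg.Gam (GeomAlg.etaComplex p q r) 1 ⊆ GeomAlg.Gam (GeomAlg.etaComplex p q r) m ∧
        GeomAlg.Gam (GeomAlg.etaComplex p q r) m ⊆
          GeomAlg.Gam (GeomAlg.etaComplex p q r) 0)) := by
  exact ⟨⟨GeomAlg.QGroup_eq_Gam _, fun _ =>
      ⟨GeomAlg.Gam_subset_Gam _ (Or.inl rfl), GeomAlg.Gam_subset_Gam _ (Or.inr rfl)⟩⟩,
    ⟨GeomAlg.QGroup_eq_Gam _, fun _ =>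
      ⟨GeomAlg.Gam_subset_Gam _ (Or.inl rfl), GeomAlg.Gam_subset_Gam _ (Or.inr rfl)⟩⟩⟩
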